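/- Let $E$ be a (real) Banach lattice and let $A\subseteq E$ be a nonempty norm bounded subset. Write $\mathrm{sol}(A)=\{y\in E: |y|\le |a| \text{ for some } a\in A\}$ for the solid hull of $A$. The set $A$ is called L-weakly compact if $\lim_{n\to\infty}\|x_n\|=0$ for every disjoint sequence $(x_n)\subset \mathrm{sol}(A)$ (disjoint means $|x_m|\wedge|x_n|=0$ for $m\neq n$). A sequence $(x_n)$ in $E$ is called uaw-null (unbounded absolutely weakly null) if $|x_n|\wedge u\to 0$ weakly for every $u\in E^+$. Then the following statements are equivalent: 1. $A$ is L-weakly compact. 2. For every uaw-null sequence $(x_n)\subset \mathrm{sol}(A)$ we have $\lim_{n\to\infty}\|x_n\|=0$. -/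

import Mathlib

open Filter Topology

/-- A sequence in a vector lattice is *disjoint* if its terms are pairwise disjoint,
`|x m| ⊓ |x n| = 0` for `m ≠ n`. -/
def IsDisjointSeq {E : Type*} [Lattice E] [AddCommGroup E] (x : ℕ → E) : Prop :=
  ∀ ⦃m n : ℕ⦄, m ≠ n → |x m| ⊓ |x n| = 0

/-- Unbounded absolute weak convergence of `x` to `a` along the filter `l`:
`|x i - a| ⊓ u` converges to zero in the weak topology of `E` for every `u ≥ 0`. -/
def UAWTendsto {ι E : Type*} [NormedAddCommGroup E] [NormedSpace ℝ E] [Lattice E]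
    (x : ι → E) (l : Filter ι) (a : E) : Prop :=
  ∀ u : E, 0 ≤ u → Tendsto (fun i => toWeakSpace ℝ E (|x i - a| ⊓ u)) l (𝓝 0)

/-- A set `A` in a Banach lattice is *L-weakly compact* if it is nonempty, norm bounded, and every
disjoint sequence in its solid hull `{y | ∃ a ∈ A, |y| ≤ |a|}` is norm null. -/
structure IsLWeaklyCompact {E : Type*} [NormedAddCommGroup E] [Lattice E] (A : Set E) : Prop where
  nonempty : A.Nonempty
  isBounded : Bornology.IsBounded A
  tendsto_norm : ∀ x : ℕ → E, (∀ n, x n ∈ LatticeOrderedAddCommGroup.solidClosure A) →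
    IsDisjointSeq x → Tendsto (fun n => ‖x n‖) atTop (𝓝 0)

/-!
If `A` is L-weakly compact, a gliding hump shows that up to `ε` its whole solid hull lies below one
finite sum `v` of positive elements of that hull, so it suffices to show that `|x n| ⊓ v` is norm
null. The singleton `{v}` is again L-weakly compact, which makes monotone sequences in `[0, v]` norm
convergent. Hence a weakly null sequence in `[0, v]` is norm null: along a subsequence on which a
suitable positive functional `f` is summable, the order limit superior `w` is a norm limit of
suprema of tails with `f w = 0`, and `f` can be chosen so that removing such a `w` costs no norm.

Conversely, if `x` is disjoint, the finite sums of the sequence `|x n| ⊓ u` stay below `u`, so every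
functional is summable along it.
-/

section Order

theorem inf_eq_zero_of_le {α : Type*} [Zero α] [SemilatticeInf α] {a b c d : α} (ha : 0 ≤ a)
    (hb : 0 ≤ b) (hac : a ≤ c) (hbd : b ≤ d) (h : c ⊓ d = 0) : a ⊓ b = 0 :=
  le_antisymm ((inf_le_inf hac hbd).trans h.le) (le_inf ha hb)

theorem posPart_smul {𝕜 E : Type*} [GroupWithZero 𝕜] [Preorder 𝕜] [AddCommGroup E] [Lattice E]
    [DistribMulAction 𝕜 E] [PosSMulMono 𝕜 E] [PosSMulReflectLE 𝕜 E] {c : 𝕜} (hc : 0 < c) (x : E) :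
    (c • x)⁺ = c • x⁺ := by
  have h := (OrderIso.smulRight hc).map_sup x 0
  simpa only [posPart_def, OrderIso.smulRight_apply, smul_zero] using h.symm

variable {E ι : Type*} [AddCommGroup E] [Lattice E] [IsOrderedAddMonoid E]

theorem inf_add_le_inf_add_inf {a b c : E} (ha : 0 ≤ a) (hb : 0 ≤ b) (hc : 0 ≤ c) :
    a ⊓ (b + c) ≤ a ⊓ b + a ⊓ c := by
  rw [inf_add, add_inf, add_inf]
  exact le_inf
    (le_inf (inf_le_left.trans (le_add_of_nonneg_left ha))
      (inf_le_left.trans (le_add_of_nonneg_right hc)))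
    (le_inf (inf_le_left.trans (le_add_of_nonneg_left hb)) inf_le_right)

theorem inf_sum_eq_zero {a : E} {b : ι → E} {s : Finset ι} (ha : 0 ≤ a) (hb : ∀ i ∈ s, 0 ≤ b i)
    (h : ∀ i ∈ s, a ⊓ b i = 0) : a ⊓ ∑ i ∈ s, b i = 0 := by
  classical
  induction s using Finset.induction_on with
  | empty => simpa using ha
  | insert i s hi ih =>
    rw [Finset.forall_mem_insert] at hb h
    have hsum : 0 ≤ ∑ j ∈ s, b j := Finset.sum_nonneg hb.2
    rw [Finset.sum_insert hi]
    refine le_antisymm ?_ (le_inf ha (add_nonneg hb.1 hsum))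
    calc a ⊓ (b i + ∑ j ∈ s, b j) ≤ a ⊓ b i + a ⊓ ∑ j ∈ s, b j :=
          inf_add_le_inf_add_inf ha hb.1 hsum
      _ = 0 := by rw [h.1, ih hb.2 h.2, add_zero]

theorem inf_nsmul_eq_zero {a b : E} (ha : 0 ≤ a) (hb : 0 ≤ b) (h : a ⊓ b = 0) (n : ℕ) :
    a ⊓ n • b = 0 := by
  simpa using inf_sum_eq_zero (s := Finset.range n) (b := fun _ => b) ha (fun _ _ => hb)
    fun _ _ => h

theorem sum_le_of_pairwise_inf_eq_zero {z : ι → E} {u : E} {s : Finset ι} (hu : 0 ≤ u)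
    (hz : ∀ i ∈ s, 0 ≤ z i) (hzu : ∀ i ∈ s, z i ≤ u)
    (hdis : (s : Set ι).Pairwise fun i j => z i ⊓ z j = 0) : ∑ i ∈ s, z i ≤ u := by
  classical
  induction s using Finset.induction_on with
  | empty => simpa using hu
  | insert i s hi ih =>
    rw [Finset.forall_mem_insert] at hz hzu
    rw [Finset.coe_insert] at hdis
    have hinf : z i ⊓ ∑ j ∈ s, z j = 0 := inf_sum_eq_zero hz.1 hz.2 fun j hj =>
      hdis (Set.mem_insert i _) (Set.mem_insert_of_mem i hj) fun hij => hi (hij ▸ hj)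
    calc ∑ j ∈ insert i s, z j = z i ⊔ ∑ j ∈ s, z j := by
          rw [Finset.sum_insert hi, ← inf_add_sup, hinf, zero_add]
      _ ≤ u := sup_le hzu.1 (ih hz.2 hzu.2 (hdis.mono (Set.subset_insert i _)))

theorem posPart_add_le (a b : E) : (a + b)⁺ ≤ a⁺ + b⁺ :=
  sup_le (add_le_add (le_posPart a) (le_posPart b))
    (add_nonneg (posPart_nonneg a) (posPart_nonneg b))

theorem posPart_sub_le_of_nonneg {a b : E} (ha : 0 ≤ a) (hb : 0 ≤ b) : (a - b)⁺ ≤ a :=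
  sup_le (sub_le_self a hb) ha

theorem IsDisjointSeq.mono {x y : ℕ → E} (hx : IsDisjointSeq x) (h : ∀ n, |y n| ≤ |x n|) :
    IsDisjointSeq y := fun m n hmn =>
  inf_eq_zero_of_le (abs_nonneg _) (abs_nonneg _) (h m) (h n) (hx hmn)

theorem isDisjointSeq_of_lt {x : ℕ → E} (hx : ∀ n, 0 ≤ x n)
    (h : ∀ m n, m < n → x m ⊓ x n = 0) : IsDisjointSeq x := by
  intro m n hmn
  rw [abs_of_nonneg (hx m), abs_of_nonneg (hx n)]
  rcases hmn.lt_or_gt with hlt | hgt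
  · exact h m n hlt
  · rw [inf_comm]
    exact h n m hgt

variable [Module ℝ E] [IsOrderedModule ℝ E]

/-- Disjointness of `z⁺` from each `(d i - η • u)⁻` makes it disjoint from their sum, which
exceeds `u`. -/
theorem nonpos_of_forall_le_posPart_sub_smul {d : ι → E} {u z : E} {s : Finset ι} {η : ℝ}
    (hd : ∀ i ∈ s, 0 ≤ d i) (hsum : ∑ i ∈ s, d i ≤ u) (hη : 2 ≤ s.card * η)
    (hz : ∀ i ∈ s, z ≤ (d i - η • u)⁺) : z ≤ 0 := by
  have hu : 0 ≤ u := (Finset.sum_nonneg hd).trans hsum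
  have hz' : ∀ i ∈ s, z⁺ ≤ (d i - η • u)⁺ := fun i hi => sup_le (hz i hi) (posPart_nonneg _)
  have hdisj : z⁺ ⊓ ∑ i ∈ s, (d i - η • u)⁻ = 0 :=
    inf_sum_eq_zero (posPart_nonneg _) (fun i _ => negPart_nonneg _) fun i hi =>
      inf_eq_zero_of_le (posPart_nonneg _) (negPart_nonneg _) (hz' i hi) le_rfl
        (posPart_inf_negPart_eq_zero _)
  have hlower : u ≤ ∑ i ∈ s, (d i - η • u)⁻ := by
    calc u = (2 : ℝ) • u - u := by rw [two_smul, add_sub_cancel_right]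
      _ ≤ (s.card * η) • u - ∑ i ∈ s, d i :=
          sub_le_sub (smul_le_smul_of_nonneg_right hη hu) hsum
      _ = ∑ i ∈ s, -(d i - η • u) := by
          simp only [neg_sub, Finset.sum_sub_distrib, Finset.sum_const, mul_smul,
            Nat.cast_smul_eq_nsmul]
      _ ≤ ∑ i ∈ s, (d i - η • u)⁻ := Finset.sum_le_sum fun i _ => neg_le_negPart _
  have hcard : 0 < (s.card : ℝ) := by
    rw [Nat.cast_pos, Finset.card_pos, Finset.nonempty_iff_ne_empty]
    rintro rfl
    norm_num at hη
  have hη0 : 0 ≤ η := (pos_of_mul_pos_right (two_pos.trans_le hη) hcard.le).le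
  obtain ⟨i, hi⟩ : s.Nonempty := Finset.card_pos.1 (Nat.cast_pos.1 hcard)
  have hupper : z⁺ ≤ u :=
    calc z⁺ ≤ (d i - η • u)⁺ := hz' i hi
      _ ≤ d i := posPart_sub_le_of_nonneg (hd i hi) (smul_nonneg hη0 hu)
      _ ≤ ∑ j ∈ s, d j := Finset.single_le_sum hd hi
      _ ≤ u := hsum
  rw [← posPart_eq_zero, ← hdisj, inf_eq_left.2 (hupper.trans hlower)]

theorem isDisjointSeq_posPart_sub {x : ℕ → E} {X : E} (hx : ∀ n, 0 ≤ x n)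
    (hX : ∀ n, (1 / 2 : ℝ) ^ n • x n ≤ X) :
    IsDisjointSeq fun n => (x n - 4 ^ n • ∑ m ∈ Finset.range n, x m - (1 / 2 : ℝ) ^ n • X)⁺ := by
  have hX0 : 0 ≤ X := (smul_nonneg (by positivity) (hx 0)).trans (hX 0)
  have hsum : ∀ n, 0 ≤ ∑ m ∈ Finset.range n, x m := fun n => Finset.sum_nonneg fun m _ => hx m
  refine isDisjointSeq_of_lt (fun n => posPart_nonneg _) fun m n hmn => ?_
  set z := x m - (1 / 4 : ℝ) ^ n • x n with hz
  have hle_posPart :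
      x m - 4 ^ m • ∑ k ∈ Finset.range m, x k - (1 / 2 : ℝ) ^ m • X ≤ z := by
    have hpow : (1 / 4 : ℝ) ^ n ≤ (1 / 2) ^ m * (1 / 2) ^ n := by
      rw [show (1 / 4 : ℝ) = 1 / 2 * (1 / 2) by norm_num, mul_pow]
      gcongr ?_ * _
      exact pow_le_pow_of_le_one (by norm_num) (by norm_num) hmn.le
    have hxn : (1 / 4 : ℝ) ^ n • x n ≤ (1 / 2 : ℝ) ^ m • X :=
      calc (1 / 4 : ℝ) ^ n • x n ≤ ((1 / 2 : ℝ) ^ m * (1 / 2) ^ n) • x n :=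
            smul_le_smul_of_nonneg_right hpow (hx n)
        _ = (1 / 2 : ℝ) ^ m • (1 / 2 : ℝ) ^ n • x n := mul_smul _ _ _
        _ ≤ (1 / 2 : ℝ) ^ m • X := smul_le_smul_of_nonneg_left (hX n) (by positivity)
    exact sub_le_sub (sub_le_self _ (nsmul_nonneg (hsum m) _)) hxn
  have hle_negPart :
      x n - 4 ^ n • ∑ k ∈ Finset.range n, x k - (1 / 2 : ℝ) ^ n • X ≤ 4 ^ n • z⁻ := by
    have hxm : x m ≤ ∑ k ∈ Finset.range n, x k :=
      Finset.single_le_sum (fun k _ => hx k) (Finset.mem_range.2 hmn)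
    have hscale : 4 ^ n • (1 / 4 : ℝ) ^ n • x n = x n := by
      rw [← Nat.cast_smul_eq_nsmul ℝ, smul_smul, Nat.cast_pow, ← mul_pow]
      norm_num
    calc x n - 4 ^ n • ∑ k ∈ Finset.range n, x k - (1 / 2 : ℝ) ^ n • X
        ≤ x n - 4 ^ n • ∑ k ∈ Finset.range n, x k :=
          sub_le_self _ (smul_nonneg (by positivity) hX0)
      _ ≤ x n - 4 ^ n • x m := sub_le_sub_left (nsmul_le_nsmul_right hxm _) _
      _ = 4 ^ n • -z := by rw [hz, neg_sub, nsmul_sub, hscale]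
      _ ≤ 4 ^ n • z⁻ := nsmul_le_nsmul_right (neg_le_negPart z) _
  exact inf_eq_zero_of_le (posPart_nonneg _) (posPart_nonneg _) (posPart_mono hle_posPart)
    (sup_le hle_negPart (nsmul_nonneg (negPart_nonneg z) _))
    (inf_nsmul_eq_zero (posPart_nonneg z) (negPart_nonneg z) (posPart_inf_negPart_eq_zero z) _)

end Order

section Approximation

open LatticeOrderedAddCommGroup (solidClosure isSolid_solidClosure)

theorem tendsto_zero_of_forall_le_add {ι : Type*} {l : Filter ι} {a : ι → ℝ} (ha : ∀ i, 0 ≤ a i)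
    (h : ∀ ε > 0, ∃ r : ι → ℝ, Tendsto r l (𝓝 0) ∧ ∀ i, a i ≤ ε + r i) : Tendsto a l (𝓝 0) := by
  refine tendsto_order.2 ⟨fun b hb => .of_forall fun i => hb.trans_le (ha i), fun b hb => ?_⟩
  obtain ⟨r, hr, har⟩ := h (b / 2) (half_pos hb)
  filter_upwards [hr.eventually_lt_const (half_pos hb)] with i hi
  linarith [har i]

theorem isBounded_solidClosure {E : Type*} [NormedAddCommGroup E] [Lattice E] [HasSolidNorm E]
    {A : Set E} (hA : Bornology.IsBounded A) :
    Bornology.IsBounded (solidClosure A) := by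
  obtain ⟨M, hM⟩ := hA.exists_norm_le
  refine isBounded_iff_forall_norm_le.2 ⟨M, ?_⟩
  rintro y ⟨a, ha, hya⟩
  exact (norm_le_norm_of_abs_le_abs hya).trans (hM a ha)

variable {E : Type*} [NormedAddCommGroup E] [Lattice E] [IsOrderedAddMonoid E]

theorem norm_le_norm_posPart_sub_add_norm_inf (a b : E) : ‖a‖ ≤ ‖(a - b)⁺‖ + ‖a ⊓ b‖ :=
  calc ‖a‖ = ‖(a - b)⁺ + a ⊓ b‖ := by rw [inf_eq_sub_posPart_sub, add_sub_cancel]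
    _ ≤ ‖(a - b)⁺‖ + ‖a ⊓ b‖ := norm_add_le _ _

theorem mem_solidClosure_of_nonneg_of_le {A : Set E} {x y : E} (hy : y ∈ solidClosure A)
    (hx : 0 ≤ x) (hxy : x ≤ y) : x ∈ solidClosure A :=
  isSolid_solidClosure A hy (by rwa [abs_of_nonneg hx, abs_of_nonneg (hx.trans hxy)])

theorem mem_solidClosure_singleton_of_mem_Icc {u x : E} (hx : x ∈ Set.Icc 0 u) :
    x ∈ solidClosure {u} :=
  mem_solidClosure_of_nonneg_of_le ⟨u, rfl, le_rfl⟩ hx.1 hx.2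

variable [HasSolidNorm E]

theorem norm_le_norm_of_nonneg_of_le {a b : E} (ha : 0 ≤ a) (hab : a ≤ b) : ‖a‖ ≤ ‖b‖ :=
  norm_le_norm_of_abs_le_abs (by rwa [abs_of_nonneg ha, abs_of_nonneg (ha.trans hab)])

theorem norm_posPart_add_le (a b : E) : ‖(a + b)⁺‖ ≤ ‖a⁺‖ + ‖b⁺‖ :=
  (norm_le_norm_of_nonneg_of_le (posPart_nonneg _) (posPart_add_le a b)).trans (norm_add_le _ _)

theorem tendsto_norm_inf_of_mem_closure {ι : Type*} {l : Filter ι} {T : Set E} {e : ι → E}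
    (hT : ∀ t ∈ T, 0 ≤ t) (he : ∀ i, 0 ≤ e i) (h : ∀ t ∈ T, Tendsto (fun i => ‖e i ⊓ t‖) l (𝓝 0))
    {v : E} (hv : v ∈ AddSubmonoid.closure T) : Tendsto (fun i => ‖e i ⊓ v‖) l (𝓝 0) := by
  have hnonneg : AddSubmonoid.closure T ≤ AddSubmonoid.nonneg E := AddSubmonoid.closure_le.2 hT
  induction hv using AddSubmonoid.closure_induction with
  | mem t ht => exact h t ht
  | zero => simpa only [inf_eq_right.2 (he _), norm_zero] using tendsto_const_nhds
  | add v w hv hw ihv ihw =>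
    have hv0 : 0 ≤ v := hnonneg hv
    have hw0 : 0 ≤ w := hnonneg hw
    refine squeeze_zero (fun i => norm_nonneg _) (fun i => ?_) (by simpa using ihv.add ihw)
    calc ‖e i ⊓ (v + w)‖ ≤ ‖e i ⊓ v + e i ⊓ w‖ :=
          norm_le_norm_of_nonneg_of_le (le_inf (he i) (add_nonneg hv0 hw0))
            (inf_add_le_inf_add_inf (he i) hv0 hw0)
      _ ≤ ‖e i ⊓ v‖ + ‖e i ⊓ w‖ := norm_add_le _ _

theorem IsLWeaklyCompact.singleton_of_mem_closure {A : Set E} (hA : IsLWeaklyCompact A) {v : E}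
    (hv : v ∈ AddSubmonoid.closure {x ∈ solidClosure A | 0 ≤ x}) : IsLWeaklyCompact {v} where
  nonempty := Set.singleton_nonempty v
  isBounded := Bornology.isBounded_singleton
  tendsto_norm x hx hdis := by
    have hv0 : 0 ≤ v := AddSubmonoid.closure_le (S := .nonneg E).2 (fun t ht => ht.2) hv
    have hxv : ∀ n, |x n| ⊓ v = |x n| := fun n => by
      obtain ⟨a, rfl, hxa⟩ := hx n
      rwa [inf_eq_left, ← abs_of_nonneg hv0]
    have hinf : ∀ t ∈ {x ∈ solidClosure A | 0 ≤ x},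
        Tendsto (fun n => ‖|x n| ⊓ t‖) atTop (𝓝 0) := fun t ht => by
      have h0 : ∀ n, 0 ≤ |x n| ⊓ t := fun n => le_inf (abs_nonneg _) ht.2
      refine hA.tendsto_norm _
        (fun n => mem_solidClosure_of_nonneg_of_le ht.1 (h0 n) inf_le_right)
        (hdis.mono fun n => ?_)
      rw [abs_of_nonneg (h0 n)]
      exact inf_le_left
    simpa only [hxv, norm_abs_eq_norm] using
      tendsto_norm_inf_of_mem_closure (fun t ht => ht.2) (fun n => abs_nonneg (x n)) hinf hv

variable [NormedSpace ℝ E] [IsOrderedModule ℝ E] [CompleteSpace E]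

theorem IsLWeaklyCompact.tendsto_norm_posPart_sub_sum {A : Set E} (hA : IsLWeaklyCompact A)
    {x : ℕ → E} (hx : ∀ n, x n ∈ solidClosure A) (hx0 : ∀ n, 0 ≤ x n) :
    Tendsto (fun n => ‖(x n - 4 ^ n • ∑ m ∈ Finset.range n, x m)⁺‖) atTop (𝓝 0) := by
  obtain ⟨M, hM⟩ := (isBounded_solidClosure hA.isBounded).exists_norm_le
  have hsummable : Summable fun n => (1 / 2 : ℝ) ^ n • x n := by
    refine .of_norm_bounded (summable_geometric_two.mul_right M) fun n => ?_
    rw [norm_smul, Real.norm_of_nonneg (by positivity)]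
    exact mul_le_mul_of_nonneg_left (hM _ (hx n)) (by positivity)
  set X := ∑' n, (1 / 2 : ℝ) ^ n • x n
  have hX : ∀ n, (1 / 2 : ℝ) ^ n • x n ≤ X := fun n =>
    hsummable.le_tsum n fun m _ => smul_nonneg (by positivity) (hx0 m)
  have hX0 : 0 ≤ X := (smul_nonneg (by positivity) (hx0 0)).trans (hX 0)
  set v : ℕ → E := fun n => x n - 4 ^ n • ∑ m ∈ Finset.range n, x m - (1 / 2 : ℝ) ^ n • X
  have hvx : ∀ n, (v n)⁺ ≤ x n := fun n => by
    have hsum : 0 ≤ ∑ m ∈ Finset.range n, x m := Finset.sum_nonneg fun m _ => hx0 m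
    simp only [v, sub_sub]
    exact posPart_sub_le_of_nonneg (hx0 n)
      (add_nonneg (nsmul_nonneg hsum _) (smul_nonneg (by positivity) hX0))
  have hv : Tendsto (fun n => ‖(v n)⁺‖) atTop (𝓝 0) :=
    hA.tendsto_norm _ (fun n => mem_solidClosure_of_nonneg_of_le (hx n) (posPart_nonneg _) (hvx n))
      (isDisjointSeq_posPart_sub hx0 hX)
  have hpow : Tendsto (fun n => (1 / 2 : ℝ) ^ n * ‖X‖) atTop (𝓝 0) := by
    simpa using (tendsto_pow_atTop_nhds_zero_of_lt_one (r := (1 / 2 : ℝ)) (by norm_num)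
      (by norm_num)).mul_const ‖X‖
  refine squeeze_zero (fun n => norm_nonneg _) (fun n => ?_)
    (by simpa only [add_zero] using hv.add hpow)
  calc ‖(x n - 4 ^ n • ∑ m ∈ Finset.range n, x m)⁺‖ = ‖(v n + (1 / 2 : ℝ) ^ n • X)⁺‖ := by
        rw [sub_add_cancel]
    _ ≤ ‖(v n)⁺‖ + ‖((1 / 2 : ℝ) ^ n • X)⁺‖ := norm_posPart_add_le _ _
    _ = ‖(v n)⁺‖ + (1 / 2 : ℝ) ^ n * ‖X‖ := by
        rw [posPart_eq_self.2 (smul_nonneg (by positivity) hX0), norm_smul,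
          Real.norm_of_nonneg (by positivity)]

theorem IsLWeaklyCompact.exists_mem_closure_norm_posPart_sub_lt {A T : Set E}
    (hA : IsLWeaklyCompact A) (hT : T ⊆ {x ∈ solidClosure A | 0 ≤ x}) {ε : ℝ} (hε : 0 < ε) :
    ∃ v ∈ AddSubmonoid.closure T, ∀ x ∈ T, ‖(x - v)⁺‖ < ε := by
  by_contra! hcon
  choose! g hgT hg using hcon
  let τ : ℕ → E := fun n => Nat.rec 0 (fun n t => t + g (4 ^ n • t)) n
  let x : ℕ → E := fun n => g (4 ^ n • τ n)
  have hτ : ∀ n, τ n = ∑ m ∈ Finset.range n, x m := fun n => by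
    induction n with
    | zero => rfl
    | succ n ih => rw [Finset.sum_range_succ, ← ih]
  have hτT : ∀ n, τ n ∈ AddSubmonoid.closure T := fun n => by
    induction n with
    | zero => exact zero_mem _
    | succ n ih => exact add_mem ih (AddSubmonoid.subset_closure (hgT _ (nsmul_mem ih _)))
  have hxT : ∀ n, x n ∈ T := fun n => hgT _ (nsmul_mem (hτT n) _)
  have hlim := hA.tendsto_norm_posPart_sub_sum (fun n => (hT (hxT n)).1) fun n => (hT (hxT n)).2
  obtain ⟨n, hn⟩ := (hlim.eventually_lt_const hε).exists
  rw [← hτ] at hn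
  exact hn.not_ge (hg _ (nsmul_mem (hτT n) _))

theorem IsLWeaklyCompact.tendsto_norm_of_tendsto_norm_inf {ι : Type*} {l : Filter ι} {A T : Set E}
    (hA : IsLWeaklyCompact A) (hT : T ⊆ {x ∈ solidClosure A | 0 ≤ x}) {e : ι → E}
    (heT : ∀ i, e i ∈ T)
    (he : ∀ v ∈ AddSubmonoid.closure T, Tendsto (fun i => ‖e i ⊓ v‖) l (𝓝 0)) :
    Tendsto (fun i => ‖e i‖) l (𝓝 0) := by
  refine tendsto_zero_of_forall_le_add (fun i => norm_nonneg _) fun ε hε => ?_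
  obtain ⟨v, hvT, hv⟩ := hA.exists_mem_closure_norm_posPart_sub_lt hT hε
  exact ⟨fun i => ‖e i ⊓ v‖, he v hvT, fun i =>
    (norm_le_norm_posPart_sub_add_norm_inf _ v).trans (by gcongr; exact (hv _ (heT i)).le)⟩

end Approximation

section OrderInterval

open LatticeOrderedAddCommGroup (solidClosure)

theorem sum_sub_le_of_monotone {E : Type*} [AddCommGroup E] [PartialOrder E]
    [IsOrderedAddMonoid E] {w : ℕ → E} {u : E} (hw : Monotone w) (hwu : ∀ n, w n ∈ Set.Icc 0 u)
    (s : Finset ℕ) : ∑ i ∈ s, (w (i + 1) - w i) ≤ u := by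
  obtain ⟨m, hm⟩ := s.exists_nat_subset_range
  calc ∑ i ∈ s, (w (i + 1) - w i) ≤ ∑ i ∈ Finset.range m, (w (i + 1) - w i) :=
        Finset.sum_le_sum_of_subset_of_nonneg hm fun i _ _ => sub_nonneg.2 (hw i.le_succ)
    _ = w m - w 0 := Finset.sum_range_sub w m
    _ ≤ u := (sub_le_self _ (hwu 0).1).trans (hwu m).2

theorem exists_monotone_forall_le_dist {α : Type*} [PseudoMetricSpace α] {w : ℕ → α}
    (hw : ¬CauchySeq w) :
    ∃ ε > 0, ∃ φ : ℕ → ℕ, Monotone φ ∧ ∀ n, ε ≤ dist (w (φ (n + 1))) (w (φ n)) := by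
  rw [Metric.cauchySeq_iff'] at hw
  push Not at hw
  obtain ⟨ε, hε, hw⟩ := hw
  choose g hg hgε using hw
  refine ⟨ε, hε, fun n => g^[n] 0, monotone_nat_of_le_succ fun n => ?_, fun n => ?_⟩
  · rw [Function.iterate_succ_apply']
    exact hg _
  · simp only [Function.iterate_succ_apply']
    exact hgε _

variable {E : Type*} [NormedAddCommGroup E] [Lattice E] [IsOrderedAddMonoid E] [HasSolidNorm E]
  [NormedSpace ℝ E] [IsOrderedModule ℝ E] [CompleteSpace E]

theorem IsLWeaklyCompact.tendsto_norm_of_forall_card_eq {A : Set E} (hA : IsLWeaklyCompact A)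
    (K : ℕ) {e : ℕ → E} (heA : ∀ n, e n ∈ solidClosure A) (he : ∀ n, 0 ≤ e n)
    (hK : ∀ s : Finset ℕ, s.card = K + 1 → ∀ z, (∀ i ∈ s, z ≤ e i) → z ≤ 0) :
    Tendsto (fun n => ‖e n‖) atTop (𝓝 0) := by
  induction K generalizing e with
  | zero =>
    have he0 : ∀ n, e n = 0 := fun n => le_antisymm (hK {n} (by simp) _ (by simp)) (he n)
    simp only [he0, norm_zero, tendsto_const_nhds]
  | succ K ih =>
    have hT : Set.range e ⊆ {x ∈ solidClosure A | 0 ≤ x} :=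
      Set.range_subset_iff.2 fun n => ⟨heA n, he n⟩
    refine hA.tendsto_norm_of_tendsto_norm_inf hT Set.mem_range_self fun v hv =>
      tendsto_norm_inf_of_mem_closure (fun t ht => (hT ht).2) he ?_ hv
    rintro _ ⟨i, rfl⟩
    have hinf : ∀ n, 0 ≤ e (n + (i + 1)) ⊓ e i := fun n => le_inf (he _) (he _)
    rw [← tendsto_add_atTop_iff_nat (i + 1)]
    refine ih (fun n => mem_solidClosure_of_nonneg_of_le (heA i) (hinf n) inf_le_right) hinf
      fun s hs z hz => hK (insert i (s.map (addRightEmbedding (i + 1)))) ?_ z ?_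
    · have hi : i ∉ s.map (addRightEmbedding (i + 1)) := by
        simp only [Finset.mem_map, addRightEmbedding_apply, not_exists, not_and]
        omega
      rw [Finset.card_insert_of_notMem hi, Finset.card_map, hs]
    · obtain ⟨j, hj⟩ : s.Nonempty := Finset.card_pos.1 (by omega)
      rw [Finset.forall_mem_insert, Finset.forall_mem_map]
      exact ⟨(hz j hj).trans inf_le_right, fun k hk => (hz k hk).trans inf_le_left⟩

/-- Truncating at `η • u` leaves a sequence in which few terms overlap. -/
theorem IsLWeaklyCompact.tendsto_norm_of_sum_le {u : E} (hu : IsLWeaklyCompact {u}) {d : ℕ → E}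
    (hd : ∀ n, 0 ≤ d n) (hsum : ∀ s : Finset ℕ, ∑ i ∈ s, d i ≤ u) :
    Tendsto (fun n => ‖d n‖) atTop (𝓝 0) := by
  have hu0 : 0 ≤ u := by simpa using hsum ∅
  have hdu : ∀ n, d n ≤ u := fun n => by simpa using hsum {n}
  have htrunc : ∀ η : ℝ, 0 < η → Tendsto (fun n => ‖(d n - η • u)⁺‖) atTop (𝓝 0) := fun η hη => by
    obtain ⟨K, hK⟩ := exists_nat_ge (2 / η)
    have hle : ∀ n, (d n - η • u)⁺ ≤ u := fun n =>
      (posPart_sub_le_of_nonneg (hd n) (smul_nonneg hη.le hu0)).trans (hdu n)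
    refine hu.tendsto_norm_of_forall_card_eq K
      (fun n => mem_solidClosure_singleton_of_mem_Icc ⟨posPart_nonneg _, hle n⟩)
      (fun n => posPart_nonneg _) fun s hs z hz =>
        nonpos_of_forall_le_posPart_sub_smul (fun i _ => hd i) (hsum s) ?_ hz
    rw [hs, ← div_le_iff₀ hη]
    exact hK.trans (by simp)
  refine tendsto_zero_of_forall_le_add (fun n => norm_nonneg _) fun ε hε => ?_
  have hη : 0 < ε / (‖u‖ + 1) := by positivity
  refine ⟨_, htrunc _ hη, fun n => ?_⟩
  set η := ε / (‖u‖ + 1)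
  have hηu : ‖η • u‖ ≤ ε := by
    rw [norm_smul, Real.norm_of_nonneg hη.le, div_mul_eq_mul_div, div_le_iff₀ (by positivity)]
    nlinarith [norm_nonneg u]
  calc ‖d n‖ ≤ ‖(d n - η • u)⁺‖ + ‖d n ⊓ η • u‖ := norm_le_norm_posPart_sub_add_norm_inf _ _
    _ ≤ ‖(d n - η • u)⁺‖ + ‖η • u‖ := by
        gcongr
        exact norm_le_norm_of_nonneg_of_le (le_inf (hd n) (smul_nonneg hη.le hu0)) inf_le_right
    _ ≤ ε + ‖(d n - η • u)⁺‖ := by rw [add_comm]; gcongr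

theorem IsLWeaklyCompact.cauchySeq_of_monotone {u : E} (hu : IsLWeaklyCompact {u}) {w : ℕ → E}
    (hw : Monotone w) (hwu : ∀ n, w n ∈ Set.Icc 0 u) : CauchySeq w := by
  by_contra hcon
  obtain ⟨ε, hε, φ, hφ, hgap⟩ := exists_monotone_forall_le_dist hcon
  have hlim : Tendsto (fun n => ‖w (φ (n + 1)) - w (φ n)‖) atTop (𝓝 0) :=
    hu.tendsto_norm_of_sum_le (fun n => sub_nonneg.2 (hw (hφ n.le_succ)))
      (sum_sub_le_of_monotone (hw.comp hφ) fun n => hwu (φ n))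
  obtain ⟨n, hn⟩ := (hlim.eventually_lt_const hε).exists
  rw [← dist_eq_norm] at hn
  exact hn.not_ge (hgap n)

theorem IsLWeaklyCompact.exists_isLUB_tendsto_partialSups {u : E} (hu : IsLWeaklyCompact {u})
    {y : ℕ → E} (hy : ∀ n, y n ∈ Set.Icc 0 u) :
    ∃ s, IsLUB (Set.range y) s ∧ Tendsto (partialSups y) atTop (𝓝 s) := by
  have hmem : ∀ n, partialSups y n ∈ Set.Icc 0 u := fun n =>
    ⟨(hy 0).1.trans (le_partialSups_of_le y n.zero_le), partialSups_le _ _ _ fun i _ => (hy i).2⟩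
  obtain ⟨s, hs⟩ := cauchySeq_tendsto_of_complete
    (hu.cauchySeq_of_monotone (partialSups y).monotone hmem)
  refine ⟨s, ?_, hs⟩
  have hlub : IsLUB (Set.range (partialSups y)) s :=
    isLUB_of_tendsto_atTop (partialSups y).monotone hs
  rwa [IsLUB, upperBounds_range_partialSups] at hlub

end OrderInterval

section Duality

theorem tendsto_toWeakSpace_zero_iff {E ι : Type*} [NormedAddCommGroup E] [NormedSpace ℝ E]
    {l : Filter ι} {y : ι → E} :
    Tendsto (fun i => toWeakSpace ℝ E (y i)) l (𝓝 0) ↔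
      ∀ f : E →L[ℝ] ℝ, Tendsto (fun i => f (y i)) l (𝓝 0) := by
  have hB : Function.Injective (topDualPairing ℝ E).flip := fun a b hab =>
    (SeparatingDual.eq_iff_forall_dual_eq (R := ℝ)).2 fun f => LinearMap.congr_fun hab f
  rw [← map_zero (toWeakSpace ℝ E)]
  refine (WeakBilin.tendsto_iff_forall_eval_tendsto _ hB).trans (forall_congr' fun f => ?_)
  change Tendsto _ l (𝓝 (f 0)) ↔ _
  rw [map_zero]
  rfl

variable {E : Type*} [NormedAddCommGroup E] [Lattice E] [IsOrderedAddMonoid E] [NormedSpace ℝ E]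

theorem map_le_tsum_of_tendsto_partialSups {f : E →L[ℝ] ℝ} (hf : Monotone f) {y : ℕ → E} {s : E}
    (hy : ∀ n, 0 ≤ y n) (hs : Tendsto (partialSups y) atTop (𝓝 s))
    (hfy : Summable fun n => f (y n)) : f s ≤ ∑' n, f (y n) := by
  refine le_of_tendsto' ((f.continuous.tendsto s).comp hs) fun n => ?_
  have hsup : partialSups y n ≤ ∑ k ∈ Finset.range (n + 1), y k :=
    partialSups_le _ _ _ fun k hk =>
      Finset.single_le_sum (fun i _ => hy i) (Finset.mem_range_succ_iff.2 hk)
  calc f (partialSups y n) ≤ f (∑ k ∈ Finset.range (n + 1), y k) := hf hsup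
    _ = ∑ k ∈ Finset.range (n + 1), f (y k) := map_sum _ _ _
    _ ≤ ∑' k, f (y k) := hfy.sum_le_tsum _ fun k _ => by
        rw [← map_zero f]
        exact hf (hy k)

variable [HasSolidNorm E] [IsOrderedModule ℝ E]

theorem exists_monotone_dual_eq_norm {y : E} (hy : 0 ≤ y) :
    ∃ f : E →L[ℝ] ℝ, Monotone f ∧ ‖f‖ ≤ 1 ∧ f y = ‖y‖ := by
  have hspan : ∀ c : ℝ, c • y = 0 → c • ‖y‖ = 0 := fun c hc => by
    rw [← norm_eq_zero, norm_smul] at hc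
    rw [smul_eq_mul, ← abs_eq_zero, abs_mul, abs_norm]
    exact hc
  let p : E →ₗ.[ℝ] ℝ := LinearPMap.mkSpanSingleton' y ‖y‖ hspan
  have hp : ∀ x : p.domain, p x ≤ ‖(x : E)⁺‖ := by
    rintro ⟨x, hx⟩
    obtain ⟨c, rfl⟩ := Submodule.mem_span_singleton.1 hx
    rw [LinearPMap.mkSpanSingleton'_apply, RingHom.id_apply, smul_eq_mul]
    rcases le_or_gt c 0 with hc | hc
    · exact (mul_nonpos_of_nonpos_of_nonneg hc (norm_nonneg y)).trans (norm_nonneg _)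
    · rw [posPart_eq_self.2 (smul_nonneg hc.le hy), norm_smul, Real.norm_of_nonneg hc.le]
  obtain ⟨g, hgy, hg⟩ := exists_extension_of_le_sublinear p (fun x => ‖x⁺‖)
    (fun c hc x => by rw [posPart_smul hc, norm_smul, Real.norm_of_nonneg hc.le])
    norm_posPart_add_le hp
  have hg_le : ∀ x, g x ≤ ‖x‖ := fun x => (hg x).trans <| norm_le_norm_of_abs_le_abs <| by
    rw [abs_of_nonneg (posPart_nonneg x)]
    exact sup_le (le_abs_self x) (abs_nonneg x)
  have hg_norm : ∀ x, ‖g x‖ ≤ 1 * ‖x‖ := fun x => by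
    rw [one_mul, Real.norm_eq_abs, abs_le']
    exact ⟨hg_le x, by simpa only [map_neg, norm_neg] using hg_le (-x)⟩
  refine ⟨g.mkContinuous 1 hg_norm, ?_, g.mkContinuous_norm_le zero_le_one hg_norm, ?_⟩
  · refine (monotone_iff_map_nonneg _).2 fun x hx => ?_
    have h := hg (-x)
    rwa [posPart_eq_zero.2 (neg_nonpos.2 hx), norm_zero, map_neg, neg_nonpos] at h
  · exact (hgy ⟨y, Submodule.mem_span_singleton_self y⟩).trans
      (LinearPMap.mkSpanSingleton'_apply_self _ _ _ _)

theorem exists_monotone_dual_norm_le {y : ℕ → E} (hy : ∀ n, 0 ≤ y n) :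
    ∃ f : E →L[ℝ] ℝ, Monotone f ∧ ∀ w, 0 ≤ w → f w = 0 → ∀ n, ‖y n‖ ≤ ‖(y n - w)⁺‖ := by
  choose F hF_mono hF_norm hFy using fun n => exists_monotone_dual_eq_norm (hy n)
  have hF0 : ∀ n x, 0 ≤ x → 0 ≤ (1 / 2 : ℝ) ^ n * F n x := fun n x hx =>
    mul_nonneg (by positivity) ((monotone_iff_map_nonneg (F n)).1 (hF_mono n) x hx)
  have hsummable : Summable fun n => (1 / 2 : ℝ) ^ n • F n := by
    refine .of_norm_bounded summable_geometric_two fun n => ?_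
    rw [norm_smul, Real.norm_of_nonneg (by positivity)]
    exact mul_le_of_le_one_right (by positivity) (hF_norm n)
  have hsum : ∀ x, HasSum (fun n => (1 / 2 : ℝ) ^ n * F n x) ((∑' n, (1 / 2 : ℝ) ^ n • F n) x) :=
    fun x => hsummable.hasSum.mapL (ContinuousLinearMap.apply ℝ ℝ x)
  refine ⟨∑' n, (1 / 2 : ℝ) ^ n • F n, (monotone_iff_map_nonneg _).2 fun x hx =>
    (hsum x).nonneg fun n => hF0 n x hx, fun w hw hfw n => ?_⟩
  have hFw : F n w = 0 := by
    have hzero : HasSum (fun n => (1 / 2 : ℝ) ^ n * F n w) 0 := hfw ▸ hsum w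
    have h := congrFun ((hasSum_zero_iff_of_nonneg fun n => hF0 n w hw).1 hzero) n
    exact (mul_eq_zero.1 h).resolve_left (by positivity)
  calc ‖y n‖ = F n (y n - w) := by rw [map_sub, hFy, hFw, sub_zero]
    _ ≤ F n (y n - w)⁺ := hF_mono n (le_posPart _)
    _ ≤ ‖F n (y n - w)⁺‖ := Real.le_norm_self _
    _ ≤ 1 * ‖(y n - w)⁺‖ := (F n).le_of_opNorm_le (hF_norm n) _
    _ = ‖(y n - w)⁺‖ := one_mul _

end Duality

section WeakConvergence

open LatticeOrderedAddCommGroup (solidClosure isSolid_solidClosure)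

theorem summable_of_abs_sum_le {ι : Type*} {a : ι → ℝ} {c : ℝ}
    (h : ∀ s : Finset ι, |∑ i ∈ s, a i| ≤ c) : Summable a := by
  have hpos : ∀ {b : ι → ℝ}, (∀ s : Finset ι, ∑ i ∈ s, b i ≤ c) → Summable fun i => (b i)⁺ :=
    fun {b} hb => summable_of_sum_le (fun i => posPart_nonneg _) fun s => by
      simpa only [posPart_eq_ite, Finset.sum_filter] using hb (s.filter fun i => 0 ≤ b i)
  have hneg : Summable fun i => (-a i)⁺ := hpos fun s => by
    rw [Finset.sum_neg_distrib]
    exact (neg_le_abs _).trans (h s)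
  simpa only [posPart_neg, posPart_sub_negPart] using
    (hpos fun s => (le_abs_self _).trans (h s)).sub hneg

variable {E : Type*} [NormedAddCommGroup E] [Lattice E] [IsOrderedAddMonoid E] [HasSolidNorm E]
  [NormedSpace ℝ E]

theorem IsDisjointSeq.uawTendsto_zero {x : ℕ → E} (hx : IsDisjointSeq x) :
    UAWTendsto x atTop 0 := by
  intro u hu
  simp only [sub_zero]
  set z : ℕ → E := fun n => |x n| ⊓ u
  have hz : ∀ n, 0 ≤ z n := fun n => le_inf (abs_nonneg _) hu
  have hsum : ∀ s : Finset ℕ, ∑ n ∈ s, z n ≤ u := fun s =>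
    sum_le_of_pairwise_inf_eq_zero hu (fun n _ => hz n) (fun n _ => inf_le_right)
      fun m _ n _ hmn => inf_eq_zero_of_le (hz m) (hz n) inf_le_left inf_le_left (hx hmn)
  refine tendsto_toWeakSpace_zero_iff.2 fun f => ?_
  refine (summable_of_abs_sum_le (c := ‖f‖ * ‖u‖) fun s => ?_).tendsto_atTop_zero
  calc |∑ n ∈ s, f (z n)| = ‖f (∑ n ∈ s, z n)‖ := by rw [map_sum, Real.norm_eq_abs]
    _ ≤ ‖f‖ * ‖∑ n ∈ s, z n‖ := f.le_opNorm _
    _ ≤ ‖f‖ * ‖u‖ := by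
        gcongr
        exact norm_le_norm_of_nonneg_of_le (Finset.sum_nonneg fun n _ => hz n) (hsum s)

variable [IsOrderedModule ℝ E] [CompleteSpace E]

/-- The witness is the order limit superior of `y`. -/
theorem IsLWeaklyCompact.exists_map_eq_zero_tendsto_norm_posPart_sub {u : E}
    (hu : IsLWeaklyCompact {u}) {f : E →L[ℝ] ℝ} (hf : Monotone f) {y : ℕ → E}
    (hy : ∀ n, y n ∈ Set.Icc 0 u) (hfy : Summable fun n => f (y n)) :
    ∃ w, 0 ≤ w ∧ f w = 0 ∧ Tendsto (fun n => ‖(y n - w)⁺‖) atTop (𝓝 0) := by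
  choose s hlub hs using fun m =>
    hu.exists_isLUB_tendsto_partialSups (y := fun k => y (k + m)) fun k => hy _
  have hle : ∀ n, y n ≤ s n := fun n => (hlub n).1 ⟨0, by simp only [zero_add]⟩
  have hs_mem : ∀ n, s n ∈ Set.Icc 0 u := fun n =>
    ⟨(hy n).1.trans (hle n), (hlub n).2 (Set.forall_mem_range.2 fun k => (hy _).2)⟩
  have hs_anti : Antitone s := fun m n hmn => (hlub n).mono (hlub m) <|
    Set.range_subset_iff.2 fun k => ⟨k + (n - m), by dsimp only; congr 1; omega⟩
  obtain ⟨v, hv⟩ := cauchySeq_tendsto_of_complete <|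
    hu.cauchySeq_of_monotone (w := fun n => u - s n)
      (fun m n hmn => sub_le_sub_left (hs_anti hmn) u)
      fun n => ⟨sub_nonneg.2 (hs_mem n).2, sub_le_self u (hs_mem n).1⟩
  obtain ⟨w, hw⟩ : ∃ w, Tendsto s atTop (𝓝 w) :=
    ⟨u - v, by simpa only [sub_sub_cancel] using hv.const_sub u⟩
  have hw0 : 0 ≤ w := ge_of_tendsto' hw fun n => (hs_mem n).1
  have hws : ∀ n, w ≤ s n := hs_anti.le_of_tendsto hw
  refine ⟨w, hw0, le_antisymm ?_ ((monotone_iff_map_nonneg f).1 hf w hw0), ?_⟩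
  · refine ge_of_tendsto' (tendsto_sum_nat_add fun n => f (y n)) fun n => (hf (hws n)).trans ?_
    exact map_le_tsum_of_tendsto_partialSups hf (fun k => (hy _).1) (hs n)
      ((summable_nat_add_iff n).2 hfy)
  · refine squeeze_zero (fun n => norm_nonneg _) (fun n => ?_)
      (tendsto_iff_norm_sub_tendsto_zero.1 hw)
    exact norm_le_norm_of_nonneg_of_le (posPart_nonneg _)
      (sup_le (sub_le_sub_right (hle n) w) (sub_nonneg.2 (hws n)))

theorem IsLWeaklyCompact.tendsto_norm_of_tendsto_toWeakSpace {u : E} (hu : IsLWeaklyCompact {u})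
    {y : ℕ → E} (hy : ∀ n, y n ∈ Set.Icc 0 u)
    (hweak : Tendsto (fun n => toWeakSpace ℝ E (y n)) atTop (𝓝 0)) :
    Tendsto (fun n => ‖y n‖) atTop (𝓝 0) := by
  obtain ⟨f, hf, hfw⟩ := exists_monotone_dual_norm_le fun n => (hy n).1
  have hf0 : ∀ n, 0 ≤ f (y n) := fun n => (monotone_iff_map_nonneg f).1 hf _ (hy n).1
  refine tendsto_of_subseq_tendsto fun ns hns => ?_
  have hfy : Tendsto (fun n => f (y (ns n))) atTop (𝓝 0) :=
    (tendsto_toWeakSpace_zero_iff.1 hweak f).comp hns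
  obtain ⟨φ, -, hφ⟩ := extraction_forall_of_eventually
    (P := fun n k => f (y (ns k)) < (1 / 2 : ℝ) ^ n) fun n =>
      hfy.eventually_lt_const (by positivity)
  obtain ⟨w, hw, hfw0, hlim⟩ := hu.exists_map_eq_zero_tendsto_norm_posPart_sub hf
    (fun n => hy (ns (φ n)))
    (Summable.of_nonneg_of_le (fun n => hf0 _) (fun n => (hφ n).le) summable_geometric_two)
  exact ⟨φ, squeeze_zero (fun n => norm_nonneg _) (fun n => hfw w hw hfw0 _) hlim⟩

theorem IsLWeaklyCompact.tendsto_norm_of_uawTendsto {A : Set E} (hA : IsLWeaklyCompact A)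
    {x : ℕ → E} (hx : ∀ n, x n ∈ solidClosure A) (hux : UAWTendsto x atTop 0) :
    Tendsto (fun n => ‖x n‖) atTop (𝓝 0) := by
  have habs : ∀ n, |x n| ∈ {y ∈ solidClosure A | 0 ≤ y} := fun n =>
    ⟨isSolid_solidClosure A (hx n) (abs_abs _).le, abs_nonneg _⟩
  simp only [← norm_abs_eq_norm (x _)]
  refine hA.tendsto_norm_of_tendsto_norm_inf subset_rfl habs fun v hv => ?_
  have hv0 : 0 ≤ v := AddSubmonoid.closure_le (S := .nonneg E).2 (fun y hy => hy.2) hv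
  refine (hA.singleton_of_mem_closure hv).tendsto_norm_of_tendsto_toWeakSpace
    (fun n => ⟨le_inf (abs_nonneg _) hv0, inf_le_right⟩) ?_
  simpa only [sub_zero] using hux v hv0

end WeakConvergence

theorem mainTheorem2 {E : Type*} [NormedAddCommGroup E] [NormedSpace ℝ E] [Lattice E]
    [IsOrderedAddMonoid E] [IsOrderedModule ℝ E] [HasSolidNorm E] [CompleteSpace E]
    (A : Set E) (hne : A.Nonempty) (hA : Bornology.IsBounded A) :
    IsLWeaklyCompact A ↔
      ∀ x : ℕ → E, (∀ n, x n ∈ LatticeOrderedAddCommGroup.solidClosure A) →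
        UAWTendsto x atTop 0 → Tendsto (fun n => ‖x n‖) atTop (𝓝 0) :=
  ⟨fun h _ hx hux => h.tendsto_norm_of_uawTendsto hx hux,
    fun h => ⟨hne, hA, fun x hx hdis => h x hx hdis.uawTendsto_zero⟩⟩
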